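/- Let $G^{\alpha}=\langle X\mid R\rangle$ be a presentation of a group $G$ with a finite generating set $X$, $|X|=n$ (different generators may represent the same element of $G$, or the trivial one). Its Cayley graph $\mathcal G$ is the labelled multigraph with vertex set $G$ and, for all $g\in G$ and $x\in X$, one edge labelled $x$ from $g$ to $gx$. For a finite connected nonempty subgraph $\mathcal H$ of $\mathcal G$ let $\xi(\mathcal H)=\operatorname{rank}(\pi_1(\mathcal H))/|V(\mathcal H)|$. An exhausting chain is an increasing sequence $C=(\mathcal G_1\subseteq\mathcal G_2\subseteq\cdots)$ of finite connected nonempty subgraphs whose union is $\mathcal G$. The normalized cyclomatic quotient of $G^{\alpha}$ is $$\hat\Xi(G^{\alpha})=1-n+\sup_{C}\,\limsup_{i\to\infty}\xi(\mathcal G_i),$$ the supremum being over all exhausting chains $C$. **Theorem.** Let $G_1$ be a normal subgroup of $G$ and let $G_2=G/G_1$, with the presentation $G_2^{\alpha_2}$ induced by $G^{\alpha}$, that is, with the same generating set $X$, each $x\in X$ representing the image in $G_2$ of the element that it represents in $G$. Then $$\hat\Xi(G^{\alpha})\le\hat\Xi(G_2^{\alpha_2})-\left(\frac1{|G_2|}-\frac1{|G|}\right),$$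 where $1/|K|$ is $0$ for an infinite group $K$. Equality holds if $G_1$ is amenable, i.e. if there is a left-invariant mean on the space of bounded complex-valued functions on $G_1$. -/

import Mathlib

noncomputable section

/-- A presentation `⟨X | R⟩` of the group `G`: `gen` sends a generator to the element of `G` which
it represents (generators may be redundant, coincide in `G`, or be trivial in `G`), and the kernel
of `FreeGroup X → G` is the normal closure of the set `rel` of relators. -/
structure GroupPresentation (X G : Type*) [Group G] where
  gen : X → G
  rel : Set (FreeGroup X)
  closure_range_gen : Subgroup.closure (Set.range gen) = ⊤
  ker_lift_gen : (FreeGroup.lift gen).ker = Subgroup.normalClosure rel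

/-- `α₂` is the presentation of `G ⧸ G₁` induced by the presentation `α` of `G`: it has the same
generating set, each generator representing the image of the element that it represents in `G`
(so all the relations of `α` hold in `α₂` as well, together with further ones). -/
def GroupPresentation.IsInducedBy {X G : Type*} [Group G] {G₁ : Subgroup G} [G₁.Normal]
    (α₂ : GroupPresentation X (G ⧸ G₁)) (α : GroupPresentation X G) : Prop :=
  ∀ x : X, α₂.gen x = QuotientGroup.mk (α.gen x)

/-- A subgraph of the Cayley graph of a presentation. The Cayley graph is the labelled multigraph
with vertex set `G` which has, for every `g : G` and `x : X`, one edge `(g, x)` labelled `x`,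
from `g` to `g * x`. -/
@[ext]
structure CayleySubgraph {X G : Type*} [Group G] (α : GroupPresentation X G) where
  verts : Set G
  edges : Set (G × X)
  source_mem : ∀ e ∈ edges, e.1 ∈ verts
  target_mem : ∀ e ∈ edges, e.1 * α.gen e.2 ∈ verts

/-- The rank of a free group (of finite rank): the number of elements of a free basis. -/
def freeRank (P : Type*) [Group P] : ℕ :=
  sInf {k : ℕ | Nonempty (FreeGroupBasis (Fin k) P)}

namespace CayleySubgraph

section

variable {X G : Type*} [Group G] {α : GroupPresentation X G}

instance : LE (CayleySubgraph α) :=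
  ⟨fun H K => H.verts ⊆ K.verts ∧ H.edges ⊆ K.edges⟩

/-- The type of vertices of a subgraph. -/
def Vertex (H : CayleySubgraph α) : Type _ := {g : G // g ∈ H.verts}

/-- The arrows from `u` to `v` are the edges of `H` from `u` to `v`. -/
instance (H : CayleySubgraph α) : Quiver H.Vertex :=
  ⟨fun u v => {x : X // (u.1, x) ∈ H.edges ∧ u.1 * α.gen x = v.1}⟩

/-- A subgraph with finitely many vertices and edges. -/
def IsFinite (H : CayleySubgraph α) : Prop :=
  H.verts.Finite ∧ H.edges.Finite

/-- The subgraph is nonempty, and any two vertices are joined by a path, in which edges may be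
traversed in both directions. -/
def IsConnected (H : CayleySubgraph α) : Prop :=
  H.verts.Nonempty ∧
    ∀ u v : H.Vertex, Nonempty (@Quiver.Path (Quiver.Symmetrify H.Vertex) _ u v)

/-- The fundamental group of the component of `v`, with base point `v`: the closed edge paths at
`v` modulo cancellation of backtracking, that is, the vertex group at `v` of the free groupoid. -/
abbrev FundGroup (H : CayleySubgraph α) (v : H.Vertex) : Type _ :=
  CategoryTheory.End ((Quiver.FreeGroupoid.of H.Vertex).obj v)

/-- The number of vertices. -/
def beta0 (H : CayleySubgraph α) : ℕ := H.verts.ncard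

/-- The cyclomatic number: the sum over all components of the rank of the fundamental group
(the base point in the component does not matter). -/
def beta2 (H : CayleySubgraph α) : ℕ :=
  ∑ᶠ c : Quiver.WeaklyConnectedComponent H.Vertex,
    freeRank (H.FundGroup (@Quotient.out _ (Quiver.zigzagSetoid H.Vertex) c))

/-- The quotient of the cyclomatic number by the number of vertices. -/
def xi (H : CayleySubgraph α) : ℝ := (H.beta2 : ℝ) / (H.beta0 : ℝ)

end

end CayleySubgraph

namespace GroupPresentation

section

variable {X G : Type*} [Group G]

/-- An exhausting chain: an increasing sequence of finite connected subgraphs of the Cayley graph,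
whose union is the whole Cayley graph. -/
structure IsExhaustingChain (α : GroupPresentation X G) (C : ℕ → CayleySubgraph α) : Prop where
  finite : ∀ i, (C i).IsFinite
  connected : ∀ i, (C i).IsConnected
  le_succ : ∀ i, C i ≤ C (i + 1)
  iUnion_verts : ⋃ i, (C i).verts = Set.univ
  iUnion_edges : ⋃ i, (C i).edges = Set.univ

/-- The cyclomatic quotient of a presentation: the supremum over all exhausting chains `C` of
`limsup ξ(C i)`. With `n` generators, all the values of `ξ` lie between `0` and `n`. -/
def cyclomaticQuotient (α : GroupPresentation X G) : ℝ :=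
  ⨆ C : {C : ℕ → CayleySubgraph α // α.IsExhaustingChain C},
    Filter.limsup (fun i => (C.1 i).xi) Filter.atTop

/-- The normalized cyclomatic quotient `1 - n + Ξ`, where `n` is the number of generators. -/
def normalizedCyclomaticQuotient [Fintype X] (α : GroupPresentation X G) : ℝ :=
  1 - (Fintype.card X : ℝ) + α.cyclomaticQuotient

end

end GroupPresentation

open scoped ComplexOrder in
/-- A group is amenable if there is a (left) invariant mean on the space of all bounded
complex-valued functions on `G`. A mean is a normalized positive linear functional. -/
def IsAmenableGroup (G : Type*) [Group G] : Prop :=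
  ∃ m : lp (fun _ : G => ℂ) ⊤ →ₗ[ℂ] ℂ,
    m 1 = 1 ∧
    (∀ f : lp (fun _ : G => ℂ) ⊤, (∀ h : G, 0 ≤ f h) → 0 ≤ m f) ∧
    (∀ (g : G) (f f' : lp (fun _ : G => ℂ) ⊤), (∀ h : G, f' h = f (g * h)) → m f' = m f)

end

/-!
For a finite set `A` of vertices of the Cayley graph let `D A` be the number of edges `(g, x)` that
leave it (`g ∈ A`, `g x ∉ A`), and let `h` be the infimum of `D A / |A|` over the finite nonempty
sets `A`. The theorem follows from the formula `Ξ̂ = 1 / |G| - h`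
(`GroupPresentation.normalizedCyclomaticQuotient_eq`): in terms of `h` it says that `h` does not
increase under quotients, and is preserved by quotients with amenable kernel.

*The formula.* A finite connected graph has cyclomatic number `|E| - |V| + 1`
(`Quiver.FreeGroupoid.freeRank_end`), so `ξ(H) = |E| / |V| - 1 + 1 / |V|`, where
`|E| ≤ n |V| - D V`, with equality for a full subgraph. Along an exhausting chain `1 / |V|` tends to
`1 / |G|`, which gives the upper bound. For the lower bound, every finite set of vertices has to be
enlarged to a finite connected `U` with `D U / |U|` close to `h` (`exists_connected_superset`). Here
the excess `D A - h |A|` is nonnegative, invariant under translation and submodular, so it is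
subadditive under unions, disjoint or not. If `A` is connected, contains `1` and has a nearly optimal
ratio, then one can keep adding two translates `g A` and `g' A`, with `g` and `g'` adjacent, of which
the first meets the set built so far and the second does not. Each time, the set stays connected and
gains at least `|A|` vertices, at the cost of at most twice the excess of `A`.

*Quotients.* Decomposing a finitely supported function `f ≥ 0` on `G` into multiples of indicator
functions of sets shows that `h ∑ f(g)` is at most the sum of `max (f(g) - f(g x)) 0` over all the
edges (`isoConst_mul_sum_le`). Pushing the indicator function of a finite subset of `G` forward to
the quotient gives `h(G / G₁) ≤ h(G)` (`isoConst_comp_le`). If `G₁` is amenable, there are finitely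
supported probability measures on `G₁` that are almost invariant under translation by given elements
(by the theorem of Hahn and Banach); spreading such a measure over the cosets in a finite subset of
the quotient gives a function on `G` that shows `h(G) ≤ h(G / G₁)`
(`isoConst_le_of_isAmenableGroup`).
-/

/-! ### Rank of the vertex group of a free groupoid -/

section FreeGroupoid

open CategoryTheory

theorem CategoryTheory.Groupoid.conj_comp {C : Type*} [Groupoid C] {r a b c : C} (P : r ⟶ a)
    (Q : r ⟶ b) (R : r ⟶ c) (f : a ⟶ b) (g : b ⟶ c) :
    P ≫ (f ≫ g) ≫ Groupoid.inv R =
      (P ≫ f ≫ Groupoid.inv Q) ≫ (Q ≫ g ≫ Groupoid.inv R) := by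
  simp

namespace Quiver

universe u v

variable {V : Type u} [Quiver.{v} V]

/-- A path that leaves a set of vertices uses an arrow with exactly one end in the set. -/
theorem exists_total_of_path {A : Set V} {r : V} (hr : r ∈ A) {w : Symmetrify V}
    (p : @Path (Symmetrify V) _ r w) (hw : (show V from w) ∉ A) :
    ∃ e : Total V, (e.left ∈ A ∧ e.right ∉ A) ∨ (e.left ∉ A ∧ e.right ∈ A) := by
  induction p with
  | nil => exact absurd hr hw
  | @cons b c p f ih =>
    by_cases hb : (show V from b) ∈ A
    · rcases f with f | f
      · exact ⟨⟨b, c, f⟩, Or.inl ⟨hb, hw⟩⟩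
      · exact ⟨⟨c, b, f⟩, Or.inr ⟨hw, hb⟩⟩
    · exact ih hb

/-- A set `T` of arrows that forms a tree on the vertex set `A` with root `r`, encoded through the
free groupoid: for `v ∈ A`, `p v` is the class of the path in the tree from `r` to `v` (for other `v`
it is arbitrary). That `p v` is composed of arrows in `T` and their inverses is expressed by
`map_eq`: a functor to a group that is trivial on `T` is trivial on `p v`. -/
structure FreeGroupoid.IsTree (r : V) (A : Set V) (T : Set (Total V))
    (p : ∀ v, (FreeGroupoid.of V).obj r ⟶ (FreeGroupoid.of V).obj v) : Prop where
  root_mem : r ∈ A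
  left_mem : ∀ e ∈ T, e.left ∈ A
  right_mem : ∀ e ∈ T, e.right ∈ A
  root : p r = 𝟙 _
  comp : ∀ e ∈ T, p e.left ≫ (FreeGroupoid.of V).map e.hom = p e.right
  map_eq : ∀ (H : Type (max u v)) [Group H] (φ : V ⥤q SingleObj H),
    (∀ e ∈ T, φ.map e.hom = (1 : H)) → ∀ v ∈ A, (FreeGroupoid.lift φ).map (p v) = (1 : H)

theorem FreeGroupoid.lift_map_of {W : Type*} [Groupoid W] (φ : V ⥤q W) {a b : V} (f : a ⟶ b) :
    (FreeGroupoid.lift φ).map ((FreeGroupoid.of V).map f) = φ.map f := by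
  have h := FreeGroupoid.lift_spec φ
  exact eq_of_heq (by
    have := congr_arg_heq (fun F : V ⥤q W => F.map f) h
    exact this)

open Classical in
/-- Adding an arrow that leaves the vertex set of a tree. -/
theorem FreeGroupoid.IsTree.extend_left {r : V} {A : Set V} {T : Set (Total V)}
    {p : ∀ v, (FreeGroupoid.of V).obj r ⟶ (FreeGroupoid.of V).obj v}
    (h : IsTree r A T p) (e : Total V) (hl : e.left ∈ A) (hr : e.right ∉ A) :
    ∃ p', IsTree r (insert e.right A) (insert e T) p' := by
  have ne : ∀ v ∈ A, v ≠ e.right := fun v hv h => hr (h ▸ hv)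
  let p' := Function.update p e.right (p e.left ≫ (FreeGroupoid.of V).map e.hom)
  have hp' : ∀ v ∈ A, p' v = p v := fun v hv => Function.update_of_ne (ne v hv) _ _
  have hp'' : p' e.right = _ := Function.update_self _ _ _
  refine ⟨p', ⟨Or.inr h.root_mem, ?_, ?_, ?_, ?_, ?_⟩⟩
  · rintro f (rfl | hf)
    · exact Or.inr hl
    · exact Or.inr (h.left_mem f hf)
  · rintro f (rfl | hf)
    · exact Or.inl rfl
    · exact Or.inr (h.right_mem f hf)
  · rw [hp' _ h.root_mem, h.root]
  · rintro f (rfl | hf)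
    · rw [hp' _ hl, hp'']
    · rw [hp' _ (h.left_mem f hf), hp' _ (h.right_mem f hf), h.comp f hf]
  · rintro H _ φ hφ v (rfl | hv)
    · rw [hp'', Functor.map_comp, lift_map_of, hφ e (Or.inl rfl),
        h.map_eq H φ (fun f hf => hφ f (Or.inr hf)) _ hl]
      exact mul_one (1 : H)
    · rw [hp' _ hv, h.map_eq H φ (fun f hf => hφ f (Or.inr hf)) _ hv]

open Classical in
/-- Adding an arrow that enters the vertex set of a tree. -/
theorem FreeGroupoid.IsTree.extend_right {r : V} {A : Set V} {T : Set (Total V)}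
    {p : ∀ v, (FreeGroupoid.of V).obj r ⟶ (FreeGroupoid.of V).obj v}
    (h : IsTree r A T p) (e : Total V) (hl : e.left ∉ A) (hr : e.right ∈ A) :
    ∃ p', IsTree r (insert e.left A) (insert e T) p' := by
  have ne : ∀ v ∈ A, v ≠ e.left := fun v hv h => hl (h ▸ hv)
  let p' := Function.update p e.left (p e.right ≫ Groupoid.inv ((FreeGroupoid.of V).map e.hom))
  have hp' : ∀ v ∈ A, p' v = p v := fun v hv => Function.update_of_ne (ne v hv) _ _
  have hp'' : p' e.left = _ := Function.update_self _ _ _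
  refine ⟨p', ⟨Or.inr h.root_mem, ?_, ?_, ?_, ?_, ?_⟩⟩
  · rintro f (rfl | hf)
    · exact Or.inl rfl
    · exact Or.inr (h.left_mem f hf)
  · rintro f (rfl | hf)
    · exact Or.inr hr
    · exact Or.inr (h.right_mem f hf)
  · rw [hp' _ h.root_mem, h.root]
  · rintro f (rfl | hf)
    · rw [hp' _ hr, hp'', Category.assoc, Groupoid.inv_comp, Category.comp_id]
    · rw [hp' _ (h.left_mem f hf), hp' _ (h.right_mem f hf), h.comp f hf]
  · rintro H _ φ hφ v (rfl | hv)
    · have h2 := h.map_eq H φ (fun f hf => hφ f (Or.inr hf)) _ hr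
      have h1 : (FreeGroupoid.lift φ).map (p e.right) = (1 : H) →
          (FreeGroupoid.lift φ).map (p e.right ≫
            Groupoid.inv ((FreeGroupoid.of V).map e.hom)) = (1 : H) := by
        intro h2
        rw [Functor.map_comp, Groupoid.inv_eq_inv, Functor.map_inv, ← Groupoid.inv_eq_inv,
          lift_map_of, hφ e (Or.inl rfl), h2]
        exact (mul_one (_ : H)).trans (inv_one (G := H))
      rw [hp'']; exact h1 h2
    · rw [hp' _ hv, h.map_eq H φ (fun f hf => hφ f (Or.inr hf)) _ hv]

/-- A finite connected quiver has a spanning tree, with one arrow fewer than there are vertices. -/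
theorem FreeGroupoid.exists_isTree_univ [Finite V] (r : V)
    (hconn : ∀ w : V, Nonempty (@Path (Symmetrify V) _ r w)) :
    ∃ (T : Set (Total V)) (p : _), IsTree r Set.univ T p ∧ T.Finite ∧
      T.ncard + 1 = Nat.card V := by
  have key : ∀ k, k + 1 ≤ Nat.card V → ∃ (A : Set V) (T : Set (Total V)) (p : _),
      IsTree r A T p ∧ T.Finite ∧ T.ncard = k ∧ A.ncard = k + 1 := by
    intro k
    induction k with
    | zero =>
      intro _
      classical
      let q : ∀ v, (FreeGroupoid.of V).obj r ⟶ (FreeGroupoid.of V).obj v :=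
        fun v => Quot.mk _ (hconn v).some
      refine ⟨{r}, ∅, Function.update q r (𝟙 _), ⟨rfl, by simp, by simp, by simp, by simp, ?_⟩,
        Set.finite_empty, by simp, by simp⟩
      rintro H _ φ - v rfl
      rw [Function.update_self, CategoryTheory.Functor.map_id]
      rfl
    | succ k ih =>
      intro hk
      obtain ⟨A, T, p, hT, hfin, hTk, hAk⟩ := ih (by omega)
      obtain ⟨w, hw⟩ : ∃ w, w ∉ A := by
        by_contra! hA
        rw [Set.eq_univ_of_forall hA, Set.ncard_univ] at hAk
        omega
      obtain ⟨e, ⟨hl, hr⟩ | ⟨hl, hr⟩⟩ := exists_total_of_path hT.root_mem (hconn w).some hw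
      · obtain ⟨p', hp'⟩ := hT.extend_left e hl hr
        refine ⟨_, _, p', hp', hfin.insert _, ?_, ?_⟩
        · rw [Set.ncard_insert_of_notMem (fun h => hr (hT.right_mem e h)) hfin, hTk]
        · rw [Set.ncard_insert_of_notMem hr, hAk]
      · obtain ⟨p', hp'⟩ := hT.extend_right e hl hr
        refine ⟨_, _, p', hp', hfin.insert _, ?_, ?_⟩
        · rw [Set.ncard_insert_of_notMem (fun h => hl (hT.left_mem e h)) hfin, hTk]
        · rw [Set.ncard_insert_of_notMem hl, hAk]
  have hpos : 0 < Nat.card V := Nat.card_pos_iff.2 ⟨⟨r⟩, inferInstance⟩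
  obtain ⟨A, T, p, hT, hfin, hTk, hAk⟩ := key (Nat.card V - 1) (by omega)
  have hA : A = Set.univ := Set.eq_of_subset_of_ncard_le (Set.subset_univ _)
    (by rw [Set.ncard_univ]; omega)
  subst hA
  exact ⟨T, p, hT, hfin, by omega⟩

/-- The vertex group at the root of a spanning tree is free on the arrows outside the tree: the
functor that sends an arrow to the generator which it stands for, or to `1` if it is in the tree, is
inverse to sending `f : a ⟶ b` outside the tree to the loop `p a ≫ f ≫ (p b)⁻¹`. -/
theorem FreeGroupoid.IsTree.nonempty_basis {r : V} {T : Set (Total V)}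
    {p : ∀ v, (FreeGroupoid.of V).obj r ⟶ (FreeGroupoid.of V).obj v}
    (h : IsTree r Set.univ T p) :
    Nonempty (FreeGroupBasis (↥Tᶜ) (End ((FreeGroupoid.of V).obj r))) := by
  classical
  let φ : V ⥤q SingleObj (FreeGroup ↥Tᶜ) :=
    { obj := fun _ => SingleObj.star _
      map := fun {a b} f => if hf : (⟨a, b, f⟩ : Total V) ∈ T then (1 : FreeGroup ↥Tᶜ)
        else FreeGroup.of ⟨⟨a, b, f⟩, hf⟩ }
  have hφ : ∀ e ∈ T, φ.map e.hom = (1 : FreeGroup ↥Tᶜ) := fun e he => dif_pos he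
  have hφ' : ∀ e : ↥Tᶜ, φ.map e.1.hom = FreeGroup.of e := fun e => dif_neg e.2
  have hp := fun v => h.map_eq _ φ hφ v (Set.mem_univ v)
  let Φ : End ((FreeGroupoid.of V).obj r) →* FreeGroup ↥Tᶜ :=
    (FreeGroupoid.lift φ).mapEnd ((FreeGroupoid.of V).obj r)
  let ψ : FreeGroup ↥Tᶜ →* End ((FreeGroupoid.of V).obj r) :=
    FreeGroup.lift fun e => End.of
      (p e.1.left ≫ (FreeGroupoid.of V).map e.1.hom ≫ Groupoid.inv (p e.1.right))
  let Ψ : Quiver.FreeGroupoid V ⥤ SingleObj (End ((FreeGroupoid.of V).obj r)) :=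
    { obj := fun _ => SingleObj.star _
      map := fun {a b} f => End.of (p a.as ≫ f ≫ Groupoid.inv (p b.as))
      map_id := fun a => by
        change p a.as ≫ 𝟙 _ ≫ Groupoid.inv (p a.as) = 𝟙 _
        rw [Category.id_comp, Groupoid.comp_inv]
      map_comp := fun {a b c} f g => by
        exact Groupoid.conj_comp _ _ _ _ _ }
  -- both functors send an arrow `f : a ⟶ b` of `V` to the loop `p a ≫ f ≫ (p b)⁻¹`
  have hΨ : FreeGroupoid.lift φ ⋙ SingleObj.mapHom _ _ ψ = Ψ := by
    rw [FreeGroupoid.lift_unique _ Ψ rfl]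
    apply FreeGroupoid.lift_unique
    refine Prefunctor.ext (fun _ => rfl) ?_
    intro a b f
    change ψ ((FreeGroupoid.lift φ).map ((FreeGroupoid.of V).map f)) =
      p a ≫ (FreeGroupoid.of V).map f ≫ Groupoid.inv (p b)
    rw [lift_map_of]
    by_cases hf : (⟨a, b, f⟩ : Total V) ∈ T
    · have h1 := hφ _ hf
      have h2 := h.comp _ hf
      dsimp only at h1 h2
      rw [h1, map_one, ← Category.assoc, h2, Groupoid.comp_inv]
      rfl
    · have h1 := hφ' ⟨_, hf⟩
      dsimp only at h1
      rw [h1]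
      exact FreeGroup.lift_apply_of
  refine ⟨⟨MonoidHom.toMulEquiv Φ ψ ?_ ?_⟩⟩
  · ext f
    have h1 := Functor.congr_hom hΨ (show (FreeGroupoid.of V).obj r ⟶ _ from f)
    have h2 : ψ (Φ f) = p r ≫ f ≫ Groupoid.inv (p r) := by
      simp only [eqToHom_refl, Category.comp_id, Category.id_comp] at h1
      exact h1
    rw [MonoidHom.comp_apply, h2, h.root]
    simp
  · apply FreeGroup.ext_hom
    intro e
    have h1 : ψ (FreeGroup.of e) = _ := FreeGroup.lift_apply_of
    rw [MonoidHom.comp_apply, h1]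
    change (FreeGroupoid.lift φ).map
      (p e.1.left ≫ (FreeGroupoid.of V).map e.1.hom ≫ Groupoid.inv (p e.1.right)) = _
    rw [Functor.map_comp, Functor.map_comp, lift_map_of, hφ', hp, Groupoid.inv_eq_inv,
      Functor.map_inv, ← Groupoid.inv_eq_inv, hp]
    change ((1 : FreeGroup ↥Tᶜ)⁻¹ * FreeGroup.of e) * 1 = FreeGroup.of e
    rw [inv_one, one_mul, mul_one]

end Quiver
/-- All free bases of a free group of finite rank have the same cardinality. -/
theorem freeRank_eq_card {P ι : Type*} [Group P] [Finite ι] (b : FreeGroupBasis ι P) :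
    freeRank P = Nat.card ι := by
  have h : {k : ℕ | Nonempty (FreeGroupBasis (Fin k) P)} = {Nat.card ι} := by
    ext k
    simp only [Set.mem_ofPred_eq, Set.mem_singleton_iff]
    constructor
    · rintro ⟨b'⟩
      have := Nat.card_congr (Equiv.ofFreeGroupEquiv (b'.repr.symm.trans b.repr))
      simpa using this
    · rintro rfl
      exact ⟨b.reindex (Finite.equivFin ι)⟩
  rw [freeRank, h, csInf_singleton]

/-- The fundamental group of a finite connected quiver has rank `|E| - |V| + 1`. -/
theorem Quiver.FreeGroupoid.freeRank_end {V : Type*} [Quiver V] [Finite V] [Finite (Quiver.Total V)]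
    (r : V) (hconn : ∀ w : V, Nonempty (@Quiver.Path (Quiver.Symmetrify V) _ r w)) :
    freeRank (End ((Quiver.FreeGroupoid.of V).obj r)) + Nat.card V =
      Nat.card (Quiver.Total V) + 1 := by
  obtain ⟨T, p, hT, hfin, hcard⟩ := FreeGroupoid.exists_isTree_univ r hconn
  obtain ⟨b⟩ := hT.nonempty_basis
  rw [freeRank_eq_card b, ← hcard, ← Set.ncard_add_ncard_compl T, Nat.card_coe_set_eq]
  omega

end FreeGroupoid

/-! ### Cyclomatic number of a finite connected subgraph -/

namespace CayleySubgraph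

variable {X G : Type*} [Group G] {α : GroupPresentation X G}

/-- The arrows of the quiver attached to a subgraph are its edges. -/
def totalEquivEdges (H : CayleySubgraph α) : Quiver.Total H.Vertex ≃ H.edges where
  toFun e := ⟨(e.left.1, e.hom.1), e.hom.2.1⟩
  invFun e := ⟨⟨e.1.1, H.source_mem _ e.2⟩, ⟨_, H.target_mem _ e.2⟩, ⟨e.1.2, e.2, rfl⟩⟩
  left_inv := by
    rintro ⟨⟨u, hu⟩, ⟨v, hv⟩, ⟨x, hx, h⟩⟩
    change u * α.gen x = v at h
    subst h
    rfl
  right_inv e := rfl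

/-- The cyclomatic number of a finite connected subgraph is `|E| - |V| + 1`. -/
theorem beta2_add_beta0 {H : CayleySubgraph α} (hfin : H.IsFinite) (hconn : H.IsConnected) :
    H.beta2 + H.beta0 = H.edges.ncard + 1 := by
  have : Finite H.Vertex := hfin.1
  have : Finite H.edges := hfin.2
  have : Finite (Quiver.Total H.Vertex) := .of_equiv _ H.totalEquivEdges.symm
  obtain ⟨⟨g, hg⟩, hpath⟩ := hconn
  have : Unique (Quiver.WeaklyConnectedComponent H.Vertex) :=
    { default := Quiver.WeaklyConnectedComponent.mk (⟨g, hg⟩ : H.Vertex)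
      uniq := by
        rintro ⟨v⟩
        exact Quotient.sound (s := Quiver.zigzagSetoid H.Vertex) (hpath _ _) }
  rw [beta2, finsum_unique]
  have h := Quiver.FreeGroupoid.freeRank_end
    (@Quotient.out _ (Quiver.zigzagSetoid H.Vertex)
      (default : Quiver.WeaklyConnectedComponent H.Vertex)) (hpath _)
  rw [Nat.card_congr H.totalEquivEdges] at h
  exact h

theorem xi_eq {H : CayleySubgraph α} (hfin : H.IsFinite) (hconn : H.IsConnected) :
    H.xi = (H.edges.ncard : ℝ) / H.verts.ncard - 1 + 1 / H.verts.ncard := by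
  have h : (H.beta2 : ℝ) + H.verts.ncard = H.edges.ncard + 1 := by
    exact_mod_cast beta2_add_beta0 hfin hconn
  have h0 : (H.verts.ncard : ℝ) ≠ 0 := by
    simpa [Set.ncard_eq_zero hfin.1] using hconn.1.ne_empty
  rw [xi, beta0, eq_sub_of_add_eq h]
  field_simp
  ring

end CayleySubgraph

/-! ### Isoperimetry of finite sets of vertices -/

section Isoperimetry

open scoped Classical Pointwise Finset

variable {X G : Type*} [Group G]

/-- The simple graph underlying the Cayley graph: loops, directions and labels are dropped. -/
def cayleySimpleGraph (s : X → G) : SimpleGraph G :=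
  SimpleGraph.fromRel fun u v => ∃ x, u * s x = v

theorem cayleySimpleGraph_adj_smul {s : X → G} (k : G) {u v : G}
    (h : (cayleySimpleGraph s).Adj u v) : (cayleySimpleGraph s).Adj (k * u) (k * v) := by
  rw [cayleySimpleGraph, SimpleGraph.fromRel_adj] at h ⊢
  simpa [mul_assoc] using h

/-- Some edge joins a nonempty proper set of vertices to its complement. -/
theorem exists_adj_of_ne_univ {s : X → G} (hs : Subgroup.closure (Set.range s) = ⊤) {S : Set G}
    (hne : S.Nonempty) (huniv : S ≠ Set.univ) :
    ∃ g ∈ S, ∃ g' ∉ S, (cayleySimpleGraph s).Adj g g' := by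
  by_contra! hcon
  have hx : ∀ x g, g ∈ S ↔ g * s x ∈ S := by
    intro x g
    constructor
    · intro h1
      by_contra h2
      exact hcon g h1 _ h2 ((SimpleGraph.fromRel_adj _ _ _).2
        ⟨fun h => h2 (h ▸ h1), Or.inl ⟨x, rfl⟩⟩)
    · intro h1
      by_contra h2
      exact hcon _ h1 _ h2 ((SimpleGraph.fromRel_adj _ _ _).2
        ⟨fun h => h2 (h ▸ h1), Or.inr ⟨x, rfl⟩⟩)
  have hall : ∀ k ∈ Subgroup.closure (Set.range s), ∀ g, g ∈ S ↔ g * k ∈ S := by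
    intro k hk
    induction hk using Subgroup.closure_induction with
    | mem k hk => obtain ⟨x, rfl⟩ := hk; exact hx x
    | one => simp
    | mul a b _ _ ha hb => intro g; rw [ha, hb, mul_assoc]
    | inv a _ ha => intro g; rw [ha (g * a⁻¹), inv_mul_cancel_right]
  obtain ⟨g, hg⟩ := hne
  refine huniv (Set.eq_univ_of_forall fun k => ?_)
  have := (hall (g⁻¹ * k) (hs ▸ Subgroup.mem_top _) g).1 hg
  rwa [mul_inv_cancel_left] at this

theorem cayleySimpleGraph_preconnected {s : X → G}
    (hs : Subgroup.closure (Set.range s) = ⊤) : (cayleySimpleGraph s).Preconnected := by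
  intro u v
  by_contra h
  obtain ⟨g, hg, g', hg', hadj⟩ := exists_adj_of_ne_univ hs
    (S := {w | (cayleySimpleGraph s).Reachable u w}) ⟨u, SimpleGraph.Reachable.refl u⟩
    (fun h' => h (h'.symm ▸ Set.mem_univ v : v ∈ {w | (cayleySimpleGraph s).Reachable u w}))
  exact hg' (SimpleGraph.Reachable.trans hg hadj.reachable)

theorem connected_induce_smul {s : X → G} {A : Finset G}
    (h : ((cayleySimpleGraph s).induce (A : Set G)).Connected) (k : G) :
    ((cayleySimpleGraph s).induce ((k • A : Finset G) : Set G)).Connected := by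
  let φ : (cayleySimpleGraph s).induce (A : Set G) →g
      (cayleySimpleGraph s).induce ((k • A : Finset G) : Set G) :=
    { toFun := fun a => ⟨k * a.1, Finset.smul_mem_smul_finset (Finset.mem_coe.1 a.2)⟩
      map_rel' := fun {a b} hab => cayleySimpleGraph_adj_smul k hab }
  refine SimpleGraph.Connected.map φ ?_ h
  rintro ⟨g, hg⟩
  obtain ⟨g', hg', rfl⟩ := Finset.mem_smul_finset.1 (Finset.mem_coe.1 hg)
  exact ⟨⟨g', hg'⟩, rfl⟩

variable [Fintype X]

/-- The number of edges `(g, x)` of the Cayley graph which leave the finite set `A` of vertices: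
`g ∈ A` and `g * s x ∉ A`. -/
noncomputable def outBoundary (s : X → G) (A : Finset G) : ℕ := ∑ x, #{g ∈ A | g * s x ∉ A}

/-- The isoperimetric constant of the Cayley graph: the infimum of the number of outgoing edges per
vertex, over the finite nonempty sets of vertices. -/
noncomputable def isoConst (s : X → G) : ℝ :=
  ⨅ A : {A : Finset G // A.Nonempty}, (outBoundary s A.1 : ℝ) / #A.1

theorem isoConst_nonneg (s : X → G) : 0 ≤ isoConst s :=
  Real.iInf_nonneg fun _ => by positivity

theorem isoConst_mul_card_le (s : X → G) (A : Finset G) :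
    isoConst s * #A ≤ outBoundary s A := by
  rcases A.eq_empty_or_nonempty with rfl | hA
  · simp
  · have h : isoConst s ≤ (outBoundary s A : ℝ) / #A :=
      ciInf_le (f := fun A : {A : Finset G // A.Nonempty} => (outBoundary s A.1 : ℝ) / #A.1)
        ⟨0, by rintro _ ⟨B, rfl⟩; positivity⟩ ⟨A, hA⟩
    have : (0 : ℝ) < #A := by exact_mod_cast hA.card_pos
    rwa [le_div_iff₀ this] at h

theorem exists_outBoundary_le (s : X → G) {ε : ℝ} (hε : 0 < ε) :
    ∃ A : Finset G, A.Nonempty ∧ outBoundary s A ≤ (isoConst s + ε) * #A := by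
  have : Nonempty {A : Finset G // A.Nonempty} := ⟨⟨{1}, Finset.singleton_nonempty _⟩⟩
  obtain ⟨⟨A, hA⟩, h⟩ := exists_lt_of_ciInf_lt (lt_add_of_pos_right (isoConst s) hε)
  have : (0 : ℝ) < #A := by exact_mod_cast hA.card_pos
  exact ⟨A, hA, ((div_lt_iff₀ this).1 h).le⟩

theorem le_isoConst {s : X → G} {c : ℝ}
    (h : ∀ A : Finset G, A.Nonempty → c * #A ≤ outBoundary s A) :
    c ≤ isoConst s := by
  have : Nonempty {A : Finset G // A.Nonempty} := ⟨⟨{1}, Finset.singleton_nonempty _⟩⟩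
  refine le_ciInf fun A => ?_
  have : (0 : ℝ) < #A.1 := by exact_mod_cast A.2.card_pos
  exact (le_div_iff₀ this).2 (h A.1 A.2)

/-- The number of outgoing edges is submodular. -/
theorem outBoundary_union_add_inter_le (s : X → G) (A B : Finset G) :
    outBoundary s (A ∪ B) + outBoundary s (A ∩ B) ≤ outBoundary s A + outBoundary s B := by
  have key : ∀ C ⊆ A ∪ B, outBoundary s C =
      ∑ x, ∑ g ∈ A ∪ B, if g ∈ C ∧ g * s x ∉ C then 1 else 0 := by
    intro C hC
    refine Finset.sum_congr rfl fun x _ => ?_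
    rw [← Finset.card_filter]
    congr 1
    ext g
    simp only [Finset.mem_filter]
    exact ⟨fun h => ⟨hC h.1, h⟩, fun h => h.2⟩
  rw [key _ subset_rfl, key _ Finset.inter_subset_union, key _ Finset.subset_union_left,
    key _ Finset.subset_union_right]
  simp only [← Finset.sum_add_distrib]
  refine Finset.sum_le_sum fun x _ => Finset.sum_le_sum fun g _ => ?_
  by_cases h1 : g ∈ A <;> by_cases h2 : g ∈ B <;> by_cases h3 : g * s x ∈ A <;>
    by_cases h4 : g * s x ∈ B <;> simp [h1, h2, h3, h4]

theorem outBoundary_smul (s : X → G) (k : G) (A : Finset G) :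
    outBoundary s (k • A) = outBoundary s A := by
  refine Finset.sum_congr rfl fun x _ => ?_
  rw [← Finset.card_smul_finset k {g ∈ A | g * s x ∉ A}]
  congr 1
  ext g
  obtain ⟨g, rfl⟩ : ∃ g', g = k * g' := ⟨k⁻¹ * g, by simp⟩
  simp [mul_assoc]

/-- The excess of a finite set of vertices: by how much the number of outgoing edges exceeds the
number forced by the isoperimetric constant. -/
noncomputable def boundaryExcess (s : X → G) (A : Finset G) : ℝ := outBoundary s A - isoConst s * #A

theorem boundaryExcess_smul (s : X → G) (k : G) (A : Finset G) :
    boundaryExcess s (k • A) = boundaryExcess s A := by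
  rw [boundaryExcess, outBoundary_smul, Finset.card_smul_finset, boundaryExcess]

/-- The excess is submodular and nonnegative, hence subadditive. -/
theorem boundaryExcess_union_le (s : X → G) (A B : Finset G) :
    boundaryExcess s (A ∪ B) ≤ boundaryExcess s A + boundaryExcess s B := by
  have h1 : (outBoundary s (A ∪ B) : ℝ) + outBoundary s (A ∩ B) ≤
      outBoundary s A + outBoundary s B := by
    exact_mod_cast outBoundary_union_add_inter_le s A B
  have h2 : (#(A ∪ B) : ℝ) + #(A ∩ B) = #A + #B := by
    exact_mod_cast Finset.card_union_add_card_inter A B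
  have h3 := isoConst_mul_card_le s (A ∩ B)
  have h4 := congrArg (isoConst s * ·) h2
  simp only [mul_add] at h4
  simp only [boundaryExcess]
  linarith

/-- Near-optimal sets for the isoperimetric problem can be taken connected, since one of the
components of a set has at most the same ratio. -/
theorem exists_connected_outBoundary_le (s : X → G) {ε : ℝ} (hε : 0 < ε) :
    ∃ A : Finset G, ((cayleySimpleGraph s).induce (A : Set G)).Connected ∧
      outBoundary s A ≤ (isoConst s + ε) * #A := by
  obtain ⟨A, hA, hle⟩ := exists_outBoundary_le s hε
  induction hn : #A using Nat.strong_induction_on generalizing A with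
  | _ n ih =>
  subst hn
  by_cases hc : ((cayleySimpleGraph s).induce (A : Set G)).Connected
  · exact ⟨A, hc, hle⟩
  have : Nonempty (A : Set G) := hA.to_subtype
  have hpre : ¬ ((cayleySimpleGraph s).induce (A : Set G)).Preconnected := fun h => hc ⟨h⟩
  simp only [SimpleGraph.Preconnected, not_forall] at hpre
  obtain ⟨u, v, huv⟩ := hpre
  let P : G → Prop := fun g => ∃ h : g ∈ (A : Set G),
    ((cayleySimpleGraph s).induce (A : Set G)).Reachable u ⟨g, h⟩
  have hP : ∀ a ∈ A, ∀ b ∈ A, (cayleySimpleGraph s).Adj a b → (P a ↔ P b) := by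
    intro a ha b hb hab
    have hab' : ((cayleySimpleGraph s).induce (A : Set G)).Adj ⟨a, ha⟩ ⟨b, hb⟩ := hab
    exact ⟨fun h => ⟨hb, h.2.trans hab'.reachable⟩,
      fun h => ⟨ha, h.2.trans hab'.symm.reachable⟩⟩
  have hcard : #{g ∈ A | P g} + #{g ∈ A | ¬ P g} = #A := Finset.card_filter_add_card_filter_not _
  have h1 : ({g ∈ A | P g} : Finset G).Nonempty :=
    ⟨u, Finset.mem_filter.2 ⟨u.2, u.2, SimpleGraph.Reachable.refl _⟩⟩
  have h2 : ({g ∈ A | ¬ P g} : Finset G).Nonempty :=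
    ⟨v, Finset.mem_filter.2 ⟨v.2, fun h => huv h.2⟩⟩
  -- an edge from one part to the complement of that part leaves `A`
  have hout : outBoundary s {g ∈ A | P g} + outBoundary s {g ∈ A | ¬ P g} ≤ outBoundary s A := by
    simp only [outBoundary, ← Finset.sum_add_distrib]
    refine Finset.sum_le_sum fun x _ => ?_
    rw [← Finset.card_filter_add_card_filter_not (s := {g ∈ A | g * s x ∉ A}) P]
    have hx : ∀ g ∈ A, g * s x ∈ A → (P g ↔ P (g * s x)) := by
      intro g hg hgx
      by_cases h : g = g * s x
      · rw [← h]
      · exact hP g hg _ hgx ((SimpleGraph.fromRel_adj _ _ _).2 ⟨h, Or.inl ⟨x, rfl⟩⟩)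
    refine Nat.add_le_add (Finset.card_le_card fun g => ?_) (Finset.card_le_card fun g => ?_)
    · simp only [Finset.mem_filter]
      rintro ⟨⟨h3, h4⟩, h5⟩
      exact ⟨⟨h3, fun h => h5 ⟨h, (hx g h3 h).1 h4⟩⟩, h4⟩
    · simp only [Finset.mem_filter]
      rintro ⟨⟨h3, h4⟩, h5⟩
      exact ⟨⟨h3, fun h => h5 ⟨h, fun h' => h4 ((hx g h3 h).2 h')⟩⟩, h4⟩
  have hout' : (outBoundary s {g ∈ A | P g} : ℝ) + outBoundary s {g ∈ A | ¬ P g} ≤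
      outBoundary s A := by exact_mod_cast hout
  have hcard' : (#{g ∈ A | P g} : ℝ) + #{g ∈ A | ¬ P g} = #A := by exact_mod_cast hcard
  have p1 := h1.card_pos
  have p2 := h2.card_pos
  by_cases hle1 : outBoundary s {g ∈ A | P g} ≤ (isoConst s + ε) * #{g ∈ A | P g}
  · exact ih _ (by omega) _ h1 hle1 rfl
  · refine ih _ (by omega) _ h2 ?_ rfl
    rw [← hcard', mul_add] at hle
    linarith

/-- A finite connected set `U` of vertices can be enlarged by two translates of a connected set `A`
containing `1`, so that the result is connected and has at least `#A` vertices more than `U`.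
The translates are by two adjacent elements `g` and `g'`, such that `g • A` meets `U` and `g' • A`
does not. -/
theorem exists_connected_union_smul [Infinite G] {s : X → G}
    (hs : Subgroup.closure (Set.range s) = ⊤) {U A : Finset G}
    (hU : ((cayleySimpleGraph s).induce (U : Set G)).Connected)
    (hA : ((cayleySimpleGraph s).induce (A : Set G)).Connected) (h1 : (1 : G) ∈ A) :
    ∃ U' : Finset G, U ⊆ U' ∧ ((cayleySimpleGraph s).induce (U' : Set G)).Connected ∧
      #U + #A ≤ #U' ∧ boundaryExcess s U' ≤ boundaryExcess s U + 2 * boundaryExcess s A := by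
  obtain ⟨u, hu⟩ := hU.nonempty
  have hu : u ∈ U := hu
  obtain ⟨g, hg, g', hg', hadj⟩ := exists_adj_of_ne_univ hs (S := ((U * A⁻¹ : Finset G) : Set G))
    ⟨u * 1⁻¹, Finset.mul_mem_mul hu (Finset.inv_mem_inv h1)⟩
    (fun h => Set.infinite_univ (h ▸ Finset.finite_toSet _))
  have hgA : g ∈ g • A := by simpa using (Finset.smul_mem_smul_finset h1 : g • (1 : G) ∈ g • A)
  have hgA' : g' ∈ g' • A := by
    simpa using (Finset.smul_mem_smul_finset h1 : g' • (1 : G) ∈ g' • A)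
  obtain ⟨w, hw, a, ha, hwa⟩ := Finset.mem_mul.1 (Finset.mem_coe.1 hg)
  have hwg : w ∈ g • A := by
    have : w = g • a⁻¹ := by rw [← hwa]; simp
    rw [this]
    exact Finset.smul_mem_smul_finset (Finset.mem_inv'.1 ha)
  have hdisj : Disjoint U (g' • A) := by
    rw [Finset.disjoint_left]
    intro z hz hz'
    obtain ⟨b, hb, rfl⟩ := Finset.mem_smul_finset.1 hz'
    refine hg' (Finset.mem_coe.2 ?_)
    have := Finset.mul_mem_mul hz (Finset.inv_mem_inv hb)
    simpa using this
  refine ⟨(U ∪ g • A) ∪ g' • A, ?_, ?_, ?_, ?_⟩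
  · exact Finset.subset_union_left.trans Finset.subset_union_left
  · have c1 : ((cayleySimpleGraph s).induce ((U ∪ g • A : Finset G) : Set G)).Connected := by
      rw [Finset.coe_union]
      exact SimpleGraph.induce_union_connected hU.preconnected
        (connected_induce_smul hA g).preconnected ⟨w, hw, hwg⟩
    rw [Finset.coe_union]
    exact SimpleGraph.connected_induce_union c1.preconnected
      (connected_induce_smul hA g').preconnected
      (Finset.mem_coe.2 (Finset.mem_union_right _ hgA)) hgA' hadj
  · rw [← Finset.card_smul_finset g' A, ← Finset.card_union_of_disjoint hdisj]
    exact Finset.card_le_card (Finset.union_subset_union_left Finset.subset_union_left)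
  · have h3 := boundaryExcess_union_le s (U ∪ g • A) (g' • A)
    have h4 := boundaryExcess_union_le s U (g • A)
    rw [boundaryExcess_smul] at h3 h4
    linarith

/-- Adding pairs of translates `N` times. -/
theorem exists_connected_superset_large [Infinite G] {s : X → G}
    (hs : Subgroup.closure (Set.range s) = ⊤) {U A : Finset G}
    (hU : ((cayleySimpleGraph s).induce (U : Set G)).Connected)
    (hA : ((cayleySimpleGraph s).induce (A : Set G)).Connected) (h1 : (1 : G) ∈ A) (N : ℕ) :
    ∃ U' : Finset G, U ⊆ U' ∧ ((cayleySimpleGraph s).induce (U' : Set G)).Connected ∧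
      #U + N * #A ≤ #U' ∧
      boundaryExcess s U' ≤ boundaryExcess s U + 2 * N * boundaryExcess s A := by
  induction N with
  | zero => exact ⟨U, subset_rfl, hU, by simp, by simp⟩
  | succ N ih =>
    obtain ⟨U', h2, h3, h4, h5⟩ := ih
    obtain ⟨U'', h2', h3', h4', h5'⟩ := exists_connected_union_smul hs h3 hA h1
    refine ⟨U'', h2.trans h2', h3', by linarith, ?_⟩
    push_cast
    linarith

/-- Every finite set of vertices lies in a finite connected one which is nearly optimal for the
isoperimetric problem. -/
theorem exists_connected_superset {s : X → G} (hs : Subgroup.closure (Set.range s) = ⊤)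
    {ε : ℝ} (hε : 0 < ε) (F : Finset G) :
    ∃ U : Finset G, F ⊆ U ∧ ((cayleySimpleGraph s).induce (U : Set G)).Connected ∧
      outBoundary s U ≤ (isoConst s + ε) * #U := by
  rcases finite_or_infinite G with hG | hG
  -- the whole group has no outgoing edges
  · have := Fintype.ofFinite G
    obtain ⟨U, hU, hc⟩ := SimpleGraph.extend_finset_to_connected
      (cayleySimpleGraph_preconnected hs) (Finset.univ_nonempty (α := G))
    have hU' : U = Finset.univ := Finset.univ_subset_iff.1 hU
    subst hU'
    refine ⟨_, Finset.subset_univ _, hc, ?_⟩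
    have h0 : outBoundary s Finset.univ = 0 := by simp [outBoundary]
    rw [h0, Nat.cast_zero]
    exact mul_nonneg (add_nonneg (isoConst_nonneg s) hε.le) (Nat.cast_nonneg _)
  · obtain ⟨U, hFU, hU⟩ := SimpleGraph.extend_finset_to_connected
      (cayleySimpleGraph_preconnected hs) (t := insert 1 F) (Finset.insert_nonempty _ _)
    obtain ⟨A, hA, hle⟩ := exists_connected_outBoundary_le s (show 0 < ε / 3 by positivity)
    obtain ⟨a, ha⟩ := hA.nonempty
    have ha : a ∈ A := ha
    -- so many steps that the excess of the initial set is negligible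
    obtain ⟨N, hN⟩ := exists_nat_ge (3 * boundaryExcess s U / ε)
    obtain ⟨U', h2, h3, h4, h5⟩ := exists_connected_superset_large hs hU
      (connected_induce_smul hA a⁻¹) (by simpa using Finset.smul_mem_smul_finset (a := a⁻¹) ha) N
    refine ⟨U', ((Finset.subset_insert _ _).trans hFU).trans h2, h3, ?_⟩
    rw [boundaryExcess_smul] at h5
    rw [Finset.card_smul_finset] at h4
    have e1 : boundaryExcess s A ≤ ε / 3 * #A := by rw [boundaryExcess]; linarith
    have e2 : (1 : ℝ) ≤ #A := by exact_mod_cast Finset.card_pos.2 ⟨a, ha⟩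
    have e3 : (N : ℝ) * #A ≤ #U' := by exact_mod_cast (by omega : N * #A ≤ #U')
    have e4 : boundaryExcess s U ≤ N * (ε / 3) := by
      rw [div_le_iff₀ hε] at hN
      linarith
    have e5 : (N : ℝ) * (ε / 3) ≤ N * (ε / 3) * #A := le_mul_of_one_le_right (by positivity) e2
    have e6 : (N : ℝ) * boundaryExcess s A ≤ N * (ε / 3 * #A) := by gcongr
    have e7 : ε * (N * #A) ≤ ε * (#U' : ℝ) := by gcongr
    have e8 : boundaryExcess s U' ≤ ε * #U' := by linarith
    rw [boundaryExcess] at e8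
    linarith

end Isoperimetry

/-! ### Cyclomatic quotient and isoperimetric constant -/

section CyclomaticQuotient

open scoped Classical Finset
open Filter Topology

variable {X G : Type*} [Group G]

/-- The full subgraph of the Cayley graph on a set of vertices. -/
def CayleySubgraph.full (α : GroupPresentation X G) (U : Set G) : CayleySubgraph α where
  verts := U
  edges := {e | e.1 ∈ U ∧ e.1 * α.gen e.2 ∈ U}
  source_mem _ h := h.1
  target_mem _ h := h.2

theorem CayleySubgraph.full_mono (α : GroupPresentation X G) {U U' : Set G} (h : U ⊆ U') :
    full α U ≤ full α U' :=
  ⟨h, fun _ he => ⟨h he.1, h he.2⟩⟩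

theorem CayleySubgraph.isConnected_full {α : GroupPresentation X G} {U : Set G}
    (h : ((cayleySimpleGraph α.gen).induce U).Connected) : (full α U).IsConnected := by
  refine ⟨Set.nonempty_coe_sort.1 h.nonempty, ?_⟩
  intro u v
  obtain ⟨p⟩ : ((cayleySimpleGraph α.gen).induce U).Reachable u v := h.preconnected _ _
  induction p with
  | nil => exact ⟨Quiver.Path.nil⟩
  | @cons a b c hab _ ih =>
    obtain ⟨q⟩ := ih
    have hab' : (cayleySimpleGraph α.gen).Adj a.1 b.1 := hab
    obtain ⟨-, ⟨x, hx⟩ | ⟨x, hx⟩⟩ := (SimpleGraph.fromRel_adj _ _ _).1 hab'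
    · let f : @Quiver.Hom (full α U).Vertex _ a b :=
        ⟨x, ⟨a.2, show a.1 * α.gen x ∈ U from hx ▸ b.2⟩, hx⟩
      exact ⟨(Quiver.Hom.toPath (V := Quiver.Symmetrify (full α U).Vertex)
        (Sum.inl f)).comp q⟩
    · let f : @Quiver.Hom (full α U).Vertex _ b a :=
        ⟨x, ⟨b.2, show b.1 * α.gen x ∈ U from hx ▸ a.2⟩, hx⟩
      exact ⟨(Quiver.Hom.toPath (V := Quiver.Symmetrify (full α U).Vertex)
        (Sum.inr f)).comp q⟩

namespace GroupPresentation

theorem IsExhaustingChain.monotone_verts {α : GroupPresentation X G} {C : ℕ → CayleySubgraph α}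
    (hC : α.IsExhaustingChain C) : Monotone fun i => (C i).verts :=
  monotone_nat_of_le_succ fun i => (hC.le_succ i).1

theorem IsExhaustingChain.eventually_subset {α : GroupPresentation X G}
    {C : ℕ → CayleySubgraph α} (hC : α.IsExhaustingChain C) (F : Finset G) :
    ∀ᶠ i in atTop, (F : Set G) ⊆ (C i).verts := by
  have : ∀ g ∈ F, ∀ᶠ i in atTop, g ∈ (C i).verts := by
    intro g _
    obtain ⟨i, hi⟩ := Set.mem_iUnion.1 (hC.iUnion_verts ▸ Set.mem_univ g)
    filter_upwards [eventually_ge_atTop i] with j hj using hC.monotone_verts hj hi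
  filter_upwards [(Filter.eventually_all_finset F).2 this] with i hi g hg using hi g hg

/-- The limit is `0` if `G` is infinite. -/
theorem IsExhaustingChain.tendsto_one_div_ncard {α : GroupPresentation X G}
    {C : ℕ → CayleySubgraph α} (hC : α.IsExhaustingChain C) :
    Tendsto (fun i => (1 : ℝ) / (C i).verts.ncard) atTop (𝓝 (1 / (Nat.card G : ℝ))) := by
  rcases finite_or_infinite G with hG | hG
  · have := Fintype.ofFinite G
    refine tendsto_const_nhds.congr' ?_
    filter_upwards [hC.eventually_subset Finset.univ] with i hi
    rw [Finset.coe_univ, Set.univ_subset_iff] at hi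
    rw [hi, Set.ncard_univ]
  · rw [Nat.card_eq_zero_of_infinite, Nat.cast_zero, div_zero]
    simp only [one_div]
    refine tendsto_inv_atTop_zero.comp (tendsto_natCast_atTop_atTop.comp ?_)
    refine tendsto_atTop.2 fun n => ?_
    obtain ⟨F, hF⟩ := Infinite.exists_subset_card_eq G n
    filter_upwards [hC.eventually_subset F] with i hi
    rw [← hF, ← Set.ncard_coe_finset]
    exact Set.ncard_le_ncard hi (hC.finite i).1

end GroupPresentation

variable [Fintype X]

theorem CayleySubgraph.isFinite_full (α : GroupPresentation X G) (U : Finset G) :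
    (full α (U : Set G)).IsFinite := by
  refine ⟨U.finite_toSet, (U ×ˢ (Finset.univ : Finset X)).finite_toSet.subset ?_⟩
  intro e he
  simpa using he.1

/-- Each of the `|X| |U|` edges starting in `U` either stays in `U` or leaves `U`. -/
theorem CayleySubgraph.ncard_edges_full (α : GroupPresentation X G) (U : Finset G) :
    (full α (U : Set G)).edges.ncard + outBoundary α.gen U = Fintype.card X * #U := by
  have h1 : (full α (U : Set G)).edges =
      ({e ∈ U ×ˢ (Finset.univ : Finset X) | e.1 * α.gen e.2 ∈ U} : Finset (G × X)) := by
    ext e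
    simp [full]
  have h2 : outBoundary α.gen U =
      #{e ∈ U ×ˢ (Finset.univ : Finset X) | e.1 * α.gen e.2 ∉ U} := by
    rw [Finset.card_filter, Finset.sum_product_right]
    simp only [outBoundary, Finset.card_filter]
  rw [h1, Set.ncard_coe_finset, h2, Finset.card_filter_add_card_filter_not, Finset.card_product,
    Finset.card_univ, mul_comm]

theorem CayleySubgraph.xi_le {α : GroupPresentation X G} {H : CayleySubgraph α}
    (hfin : H.IsFinite) (hconn : H.IsConnected) :
    H.xi ≤ Fintype.card X - 1 - isoConst α.gen + 1 / H.verts.ncard := by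
  obtain ⟨U, hU⟩ := hfin.1.exists_finset_coe
  have h1 : H.edges.ncard ≤ (full α (U : Set G)).edges.ncard :=
    Set.ncard_le_ncard (fun e he => hU ▸ ⟨H.source_mem e he, H.target_mem e he⟩)
      (isFinite_full α U).2
  have h2 := ncard_edges_full α U
  have h3 := isoConst_mul_card_le α.gen U
  have hpos : (0 : ℝ) < H.verts.ncard := by
    exact_mod_cast (Set.ncard_pos hfin.1).2 hconn.1
  have h4 : (H.edges.ncard : ℝ) + outBoundary α.gen U ≤ Fintype.card X * H.verts.ncard := by
    rw [← hU, Set.ncard_coe_finset]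
    exact_mod_cast (by omega)
  have h5 : (H.edges.ncard : ℝ) / H.verts.ncard ≤ Fintype.card X - isoConst α.gen := by
    rw [div_le_iff₀ hpos]
    rw [← hU, Set.ncard_coe_finset] at h4 ⊢
    linarith
  rw [xi_eq hfin hconn]
  linarith

theorem CayleySubgraph.le_xi_full {α : GroupPresentation X G} {U : Finset G} {c : ℝ}
    (hU : ((cayleySimpleGraph α.gen).induce (U : Set G)).Connected)
    (hc : outBoundary α.gen U ≤ c * #U) :
    Fintype.card X - 1 - c + 1 / #U ≤ (full α (U : Set G)).xi := by
  have h1 : ((full α (U : Set G)).edges.ncard : ℝ) + outBoundary α.gen U =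
      Fintype.card X * #U := by
    exact_mod_cast ncard_edges_full α U
  obtain ⟨u, hu⟩ := hU.nonempty
  have hpos : (0 : ℝ) < #U := by exact_mod_cast Finset.card_pos.2 ⟨u, hu⟩
  have h5 : Fintype.card X - c ≤ ((full α (U : Set G)).edges.ncard : ℝ) / #U := by
    rw [le_div_iff₀ hpos]
    linarith
  rw [xi_eq (isFinite_full α U) (isConnected_full hU)]
  change _ ≤ _ / (((U : Set G).ncard : ℕ) : ℝ) - 1 + 1 / (((U : Set G).ncard : ℕ) : ℝ)
  rw [Set.ncard_coe_finset]
  linarith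

namespace GroupPresentation

theorem IsExhaustingChain.isBoundedUnder_xi {α : GroupPresentation X G}
    {C : ℕ → CayleySubgraph α} (hC : α.IsExhaustingChain C) :
    IsBoundedUnder (· ≤ ·) atTop fun i => (C i).xi :=
  (hC.tendsto_one_div_ncard.const_add _).isBoundedUnder_le.mono_le
    (Eventually.of_forall fun i => CayleySubgraph.xi_le (hC.finite i) (hC.connected i))

theorem IsExhaustingChain.limsup_xi_le {α : GroupPresentation X G}
    {C : ℕ → CayleySubgraph α} (hC : α.IsExhaustingChain C) :
    limsup (fun i => (C i).xi) atTop ≤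
      Fintype.card X - 1 - isoConst α.gen + 1 / (Nat.card G : ℝ) := by
  have ht := hC.tendsto_one_div_ncard.const_add (Fintype.card X - 1 - isoConst α.gen)
  rw [← ht.limsup_eq]
  refine limsup_le_limsup
    (Eventually.of_forall fun i => CayleySubgraph.xi_le (hC.finite i) (hC.connected i)) ?_
    ht.isBoundedUnder_le
  exact IsBoundedUnder.isCoboundedUnder_le
    (isBoundedUnder_of ⟨0, fun i => div_nonneg (Nat.cast_nonneg _) (Nat.cast_nonneg _)⟩)

/-- An exhausting chain along which the cyclomatic quotients are nearly as large as the
isoperimetric constant allows. -/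
theorem exists_isExhaustingChain (α : GroupPresentation X G) {ε : ℝ} (hε : 0 < ε) :
    ∃ C, α.IsExhaustingChain C ∧
      Fintype.card X - 1 - (isoConst α.gen + ε) + 1 / (Nat.card G : ℝ) ≤
        limsup (fun i => (C i).xi) atTop := by
  have hcount : Countable G := by
    refine Function.Surjective.countable (f := FreeGroup.lift α.gen) ?_
    rw [← MonoidHom.range_eq_top, FreeGroup.range_lift_eq_closure, α.closure_range_gen]
  obtain ⟨enum, henum⟩ := exists_surjective_nat G
  choose ext hext hconn hout using
    fun F : Finset G => exists_connected_superset α.closure_range_gen hε F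
  obtain ⟨U, hU0, hUs⟩ : ∃ U : ℕ → Finset G, U 0 = ext ∅ ∧
      ∀ i, U (i + 1) = ext (insert (enum i) (U i)) :=
    ⟨fun i => Nat.rec (ext ∅) (fun j V => ext (insert (enum j) V)) i, rfl, fun _ => rfl⟩
  have hU : ∀ i, ∃ F, U i = ext F := by
    rintro (_ | i)
    exacts [⟨_, hU0⟩, ⟨_, hUs i⟩]
  have hsucc : ∀ i, insert (enum i) (U i) ⊆ U (i + 1) := fun i => hUs i ▸ hext _
  have hmono : Monotone U :=
    monotone_nat_of_le_succ fun i => (Finset.subset_insert _ _).trans (hsucc i)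
  have hUconn : ∀ i, ((cayleySimpleGraph α.gen).induce (U i : Set G)).Connected := by
    intro i
    obtain ⟨F, hF⟩ := hU i
    exact hF ▸ hconn F
  have hUout : ∀ i, outBoundary α.gen (U i) ≤ (isoConst α.gen + ε) * #(U i) := by
    intro i
    obtain ⟨F, hF⟩ := hU i
    exact hF ▸ hout F
  have hmem : ∀ g, ∃ i, g ∈ U i := by
    intro g
    obtain ⟨i, rfl⟩ := henum g
    exact ⟨i + 1, hsucc i (Finset.mem_insert_self _ _)⟩
  have hC : α.IsExhaustingChain (fun i => CayleySubgraph.full α (U i : Set G)) :=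
    { finite := fun i => CayleySubgraph.isFinite_full α _
      connected := fun i => CayleySubgraph.isConnected_full (hUconn i)
      le_succ := fun i => CayleySubgraph.full_mono α (Finset.coe_subset.2 (hmono (Nat.le_succ i)))
      iUnion_verts := Set.eq_univ_of_forall fun g => Set.mem_iUnion.2 (hmem g)
      iUnion_edges := by
        refine Set.eq_univ_of_forall fun e => Set.mem_iUnion.2 ?_
        obtain ⟨i, hi⟩ := hmem e.1
        obtain ⟨j, hj⟩ := hmem (e.1 * α.gen e.2)
        exact ⟨max i j, hmono (le_max_left _ _) hi, hmono (le_max_right _ _) hj⟩ }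
  refine ⟨_, hC, ?_⟩
  have ht := hC.tendsto_one_div_ncard.const_add (Fintype.card X - 1 - (isoConst α.gen + ε))
  rw [← ht.limsup_eq]
  refine limsup_le_limsup (Eventually.of_forall fun i => ?_) ht.isCoboundedUnder_le
    hC.isBoundedUnder_xi
  have := CayleySubgraph.le_xi_full (hUconn i) (hUout i)
  rwa [← Set.ncard_coe_finset] at this

/-- The normalized cyclomatic quotient in terms of the isoperimetric constant. -/
theorem normalizedCyclomaticQuotient_eq (α : GroupPresentation X G) :
    α.normalizedCyclomaticQuotient = 1 / (Nat.card G : ℝ) - isoConst α.gen := by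
  have hle : ∀ C : {C : ℕ → CayleySubgraph α // α.IsExhaustingChain C},
      limsup (fun i => (C.1 i).xi) atTop ≤
        Fintype.card X - 1 - isoConst α.gen + 1 / (Nat.card G : ℝ) :=
    fun C => C.2.limsup_xi_le
  have h : α.cyclomaticQuotient =
      Fintype.card X - 1 - isoConst α.gen + 1 / (Nat.card G : ℝ) := by
    refine le_antisymm ?_ (le_of_forall_pos_le_add fun ε hε => ?_)
    · obtain ⟨C, hC, -⟩ := α.exists_isExhaustingChain one_pos
      have : Nonempty {C : ℕ → CayleySubgraph α // α.IsExhaustingChain C} := ⟨⟨C, hC⟩⟩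
      exact ciSup_le hle
    · obtain ⟨C, hC, h⟩ := α.exists_isExhaustingChain hε
      have := le_ciSup (f := fun C : {C : ℕ → CayleySubgraph α // α.IsExhaustingChain C} =>
        limsup (fun i => (C.1 i).xi) atTop) ⟨_, Set.forall_mem_range.2 hle⟩ ⟨C, hC⟩
      rw [cyclomaticQuotient]
      linarith
  rw [normalizedCyclomaticQuotient, h]
  ring

end GroupPresentation

end CyclomaticQuotient

/-! ### Isoperimetry of functions and quotients -/

section IsoperimetryOfFunctions

open scoped Classical Finset

variable {X G : Type*} [Group G] [Fintype X]

/-- The isoperimetric inequality for functions, obtained from the one for sets by decomposing a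
finitely supported nonnegative function into multiples of indicator functions. -/
theorem isoConst_mul_sum_le (s : X → G) (A : Finset G) (f : G → ℝ) (hf : ∀ g, 0 ≤ f g)
    (hA : ∀ g ∉ A, f g = 0) :
    isoConst s * ∑ g ∈ A, f g ≤ ∑ x, ∑ g ∈ A, max (f g - f (g * s x)) 0 := by
  induction hn : #{g ∈ A | f g ≠ 0} using Nat.strong_induction_on generalizing f with
  | _ n ih =>
  subst hn
  rcases ({g ∈ A | f g ≠ 0} : Finset G).eq_empty_or_nonempty with hB | hB
  · have h0 : ∑ g ∈ A, f g = 0 := Finset.sum_eq_zero fun g hg => by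
      by_contra h
      exact Finset.notMem_empty g (hB ▸ Finset.mem_filter.2 ⟨hg, h⟩)
    rw [h0, mul_zero]
    positivity
  -- subtract from `f` its least positive value on all of its support, which becomes smaller
  obtain ⟨b, hb, hmin⟩ := Finset.exists_min_image _ f hB
  have hmem : ∀ g, g ∈ ({g ∈ A | f g ≠ 0} : Finset G) ↔ f g ≠ 0 := by
    intro g
    rw [Finset.mem_filter, and_iff_right_iff_imp]
    exact fun h => by_contra fun h' => h (hA g h')
  set B : Finset G := {g ∈ A | f g ≠ 0} with hBdef
  have hBA : B ⊆ A := Finset.filter_subset _ _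
  have hfB : ∀ g ∉ B, f g = 0 := fun g hg => by
    rw [hmem, not_not] at hg
    exact hg
  let f' : G → ℝ := fun g => f g - if g ∈ B then f b else 0
  have hf'1 : ∀ g ∈ B, f' g = f g - f b := fun g hg => by simp only [f', if_pos hg]
  have hf'0 : ∀ g ∉ B, f' g = 0 := fun g hg => by simp only [f', if_neg hg, hfB g hg, sub_zero]
  have hf' : ∀ g, 0 ≤ f' g := by
    intro g
    by_cases hg : g ∈ B
    · rw [hf'1 g hg]
      exact sub_nonneg.2 (hmin g hg)
    · rw [hf'0 g hg]
  have hlt : #{g ∈ A | f' g ≠ 0} < #B := by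
    refine Finset.card_lt_card (Finset.ssubset_iff_subset_ne.2 ⟨fun g hg => ?_, fun h => ?_⟩)
    · by_contra h
      exact (Finset.mem_filter.1 hg).2 (hf'0 g h)
    · have := (Finset.mem_filter.1 (h ▸ hb : b ∈ ({g ∈ A | f' g ≠ 0} : Finset G))).2
      rw [hf'1 b hb, sub_self] at this
      exact this rfl
  have h1 := ih _ hlt f' hf' (fun g hg => hf'0 g fun h => hg (hBA h)) rfl
  have h2 : ∑ g ∈ A, f g = ∑ g ∈ A, f' g + f b * #B := by
    simp only [f', Finset.sum_sub_distrib, Finset.sum_ite_mem, Finset.sum_const,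
      Finset.inter_eq_right.2 hBA, nsmul_eq_mul]
    ring
  have h3 : (∑ x, ∑ g ∈ A, max (f' g - f' (g * s x)) 0) + f b * outBoundary s B ≤
      ∑ x, ∑ g ∈ A, max (f g - f (g * s x)) 0 := by
    rw [outBoundary, Nat.cast_sum, Finset.mul_sum, ← Finset.sum_add_distrib]
    refine Finset.sum_le_sum fun x _ => ?_
    have h4 : #{g ∈ B | g * s x ∉ B} = #{g ∈ A | g ∈ B ∧ g * s x ∉ B} := by
      congr 1
      ext g
      simp only [Finset.mem_filter]
      exact ⟨fun h => ⟨hBA h.1, h⟩, fun h => h.2⟩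
    rw [h4, Finset.card_filter, Nat.cast_sum, Finset.mul_sum, ← Finset.sum_add_distrib]
    refine Finset.sum_le_sum fun g _ => ?_
    by_cases hg : g ∈ B
    · by_cases hgx : g * s x ∈ B
      · simp [hf'1 _ hg, hf'1 _ hgx, hg, hgx]
      · rw [hf'1 _ hg, hf'0 _ hgx, hfB _ hgx]
        simp [hg, hgx, hmin g hg, hf g]
    · rw [hf'0 g hg, if_neg (fun h => hg h.1)]
      refine le_trans (le_of_eq ?_) (le_max_right _ _)
      simp [hf' (g * s x)]
  have h5 := mul_le_mul_of_nonneg_left (isoConst_mul_card_le s B) (hf b)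
  rw [h2]
  linarith

/-- The isoperimetric constant does not increase under homomorphisms: push the indicator function
of a finite set forward. -/
theorem isoConst_comp_le {Q : Type*} [Group Q] (π : G →* Q) (s : X → G) :
    isoConst (fun x => π (s x)) ≤ isoConst s := by
  refine le_isoConst fun A _ => ?_
  let f : Q → ℝ := fun q => (#{a ∈ A | π a = q} : ℝ)
  have h := isoConst_mul_sum_le (fun x => π (s x)) (A.image π) f
    (fun q => Nat.cast_nonneg _) (fun q hq => by
      simp only [f, Nat.cast_eq_zero, Finset.card_eq_zero, Finset.filter_eq_empty_iff]
      rintro a ha rfl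
      exact hq (Finset.mem_image_of_mem _ ha))
  have hsum : ∑ q ∈ A.image π, f q = #A := by
    rw [Finset.card_eq_sum_card_image π A, Nat.cast_sum]
  rw [hsum] at h
  refine h.trans ?_
  rw [outBoundary, Nat.cast_sum]
  refine Finset.sum_le_sum fun x _ => ?_
  have h1 : #{a ∈ A | a * s x ∉ A} =
      ∑ q ∈ A.image π, #{a ∈ ({a ∈ A | a * s x ∉ A} : Finset G) | π a = q} :=
    Finset.card_eq_sum_card_fiberwise fun a ha =>
      Finset.mem_image_of_mem _ (Finset.mem_filter.1 ha).1
  rw [h1, Nat.cast_sum]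
  refine Finset.sum_le_sum fun q _ => max_le ?_ (Nat.cast_nonneg _)
  -- right multiplication by `s x` maps the part of the fibre that stays in `A` to the next fibre
  have h2 : #{a ∈ ({a ∈ A | π a = q} : Finset G) | a * s x ∈ A} ≤
      #{a ∈ A | π a = q * π (s x)} := by
    refine Finset.card_le_card_of_injOn (· * s x) (fun a ha => ?_) (mul_left_injective _).injOn
    simp only [Finset.coe_filter, Finset.mem_filter, Set.mem_ofPred_eq] at ha ⊢
    exact ⟨ha.2, by rw [map_mul, ha.1.2]⟩
  have h3 := Finset.card_filter_add_card_filter_not (s := {a ∈ A | π a = q}) (· * s x ∈ A)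
  have h4 : #{a ∈ ({a ∈ A | a * s x ∉ A} : Finset G) | π a = q} =
      #{a ∈ ({a ∈ A | π a = q} : Finset G) | a * s x ∉ A} := by
    rw [Finset.filter_comm]
  rw [sub_le_iff_le_add, h4]
  have h5 : #{a ∈ A | π a = q} ≤ #{a ∈ ({a ∈ A | π a = q} : Finset G) | a * s x ∉ A} +
      #{a ∈ A | π a = q * π (s x)} := by omega
  simp only [f]
  exact_mod_cast h5

end IsoperimetryOfFunctions

/-! ### Amenable kernels -/

section Amenable

open scoped Classical Finset ENNReal ComplexOrder

/-- Day's trick: on an amenable group there are finitely supported probability measures that are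
almost invariant, in the `ℓ¹` norm, under left translation by finitely many given elements.
Otherwise the theorem of Hahn and Banach separates `0` from all the tuples of differences, and so
provides bounded functions `φ s` such that `∑ s, (φ s (s * k) - φ s k)` is bounded away from `0`;
this contradicts the existence of an invariant mean. -/
theorem IsAmenableGroup.exists_almost_left_invariant {K : Type*} [Group K] (hK : IsAmenableGroup K)
    (S : Finset K) {ε : ℝ} (hε : 0 < ε) :
    ∃ p : K →₀ ℝ, (∀ k, 0 ≤ p k) ∧ ∑ k ∈ p.support, p k = 1 ∧
      ∀ s ∈ S, ∀ A : Finset K, ∑ k ∈ A, |p (s⁻¹ * k) - p k| ≤ ε := by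
  obtain ⟨m, hm1, hmpos, hminv⟩ := hK
  have : Fact ((1 : ℝ≥0∞) ≤ 1) := ⟨le_rfl⟩
  let δ : K → lp (fun _ : K => ℝ) 1 := fun k => lp.single 1 k 1
  have hδ : ∀ k, ‖δ k‖ = 1 := fun k => by
    rw [lp.norm_single one_pos, norm_one]
  let d : K → (S → lp (fun _ : K => ℝ) 1) := fun k s => δ (s * k) - δ k
  let L := Finsupp.linearCombination ℝ d
  let P : Set (K →₀ ℝ) := {p | (∀ k, 0 ≤ p k) ∧ Finsupp.linearCombination ℝ (fun _ => (1 : ℝ)) p = 1}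
  have hP : Convex ℝ P := by
    rintro p ⟨hp, hp1⟩ q ⟨hq, hq1⟩ a b ha hb hab
    refine ⟨fun k => ?_, ?_⟩
    · have := hp k
      have := hq k
      simp only [Finsupp.add_apply, Finsupp.smul_apply, smul_eq_mul]
      positivity
    · rw [map_add, map_smul, map_smul, hp1, hq1]
      simpa using hab
  by_cases h0 : (0 : S → lp (fun _ : K => ℝ) 1) ∈ closure (L '' P)
  · obtain ⟨_, ⟨p, ⟨hp, hp1⟩, rfl⟩, hdist⟩ := Metric.mem_closure_iff.1 h0 ε hε
    rw [dist_comm, dist_zero_right] at hdist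
    refine ⟨p, hp, ?_, fun s hs A => ?_⟩
    · simpa [Finsupp.linearCombination_apply, Finsupp.sum] using hp1
    · have h1 : ‖L p ⟨s, hs⟩‖ ≤ ε := (norm_le_pi_norm _ _).trans hdist.le
      have h2 := lp.sum_rpow_le_norm_rpow (p := 1) (by simp) (L p ⟨s, hs⟩) A
      simp only [ENNReal.toReal_one, Real.rpow_one] at h2
      refine le_trans (le_of_eq (Finset.sum_congr rfl fun k _ => ?_)) (h2.trans h1)
      rw [Real.norm_eq_abs]
      congr 1
      have h3 : L p ⟨s, hs⟩ = ∑ j ∈ p.support, p j • (δ (s * j) - δ j) := by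
        simp [L, d, Finsupp.linearCombination_apply, Finsupp.sum]
      rw [h3, lp.coeFn_sum, Finset.sum_apply]
      have h4 : ∀ j, (p j • (δ (s * j) - δ j)) k =
          (if j = s⁻¹ * k then p j else 0) - (if j = k then p j else 0) := by
        intro j
        have e1 : (δ (s * j)) k = if j = s⁻¹ * k then 1 else 0 := by
          simp only [δ, lp.single_apply, Pi.single_apply]
          congr 1
          rw [eq_inv_mul_iff_mul_eq, eq_comm (a := k)]
        have e2 : (δ j) k = if j = k then 1 else 0 := by
          simp only [δ, lp.single_apply, Pi.single_apply, eq_comm]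
        rw [lp.coeFn_smul, Pi.smul_apply, lp.coeFn_sub, Pi.sub_apply, e1, e2]
        simp [mul_sub]
      simp only [h4, Finset.sum_sub_distrib, Finset.sum_ite_eq', Finsupp.mem_support_iff]
      congr 1
      · split_ifs with h <;> simp_all
      · split_ifs with h <;> simp_all
  · exfalso
    obtain ⟨f, u, hu, hf⟩ := geometric_hahn_banach_point_closed
      (hP.linear_image L).closure isClosed_closure h0
    rw [map_zero] at hu
    let φ : S → K → ℝ := fun s k => f (Pi.single s (δ k))
    have hφ : ∀ s k, |φ s k| ≤ ‖f‖ := by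
      intro s k
      refine (f.le_opNorm _).trans ?_
      rw [Pi.norm_single (G := fun _ : S => lp (fun _ : K => ℝ) 1), hδ, mul_one]
    have hsum : ∀ k, u < ∑ s, (φ s (s * k) - φ s k) := by
      intro k
      have h1 : L (Finsupp.single k 1) ∈ closure (L '' P) := by
        refine subset_closure ⟨_, ⟨fun j => ?_, ?_⟩, rfl⟩
        · rw [Finsupp.single_apply]
          positivity
        · simp
      have h2 : L (Finsupp.single k 1) = ∑ s : S, Pi.single s (d k s) := by
        rw [Finset.univ_sum_single]
        simp [L]
      have h3 := hf _ h1
      rw [h2, map_sum] at h3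
      simpa only [d, Pi.single_sub, map_sub] using h3
    let F : S → lp (fun _ : K => ℂ) ⊤ := fun s => ⟨fun k => (φ s k : ℂ), memℓp_infty
      ⟨‖f‖, by rintro _ ⟨k, rfl⟩; simpa using hφ s k⟩⟩
    let F' : S → lp (fun _ : K => ℂ) ⊤ := fun s => ⟨fun k => (φ s (s * k) : ℂ), memℓp_infty
      ⟨‖f‖, by rintro _ ⟨k, rfl⟩; simpa using hφ s (s * k)⟩⟩
    have hF : ∀ s, m (F' s) = m (F s) := fun s => hminv s (F s) (F' s) fun k => rfl
    have h1 := hmpos (∑ s, (F' s - F s) - (u : ℂ) • 1) (fun k => by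
      have h2 : (∑ s, (F' s - F s) - (u : ℂ) • (1 : lp (fun _ : K => ℂ) ⊤)) k =
          ((∑ s, (φ s (s * k) - φ s k) - u : ℝ) : ℂ) := by
        rw [lp.coeFn_sub, Pi.sub_apply, lp.coeFn_sum, Finset.sum_apply, lp.coeFn_smul,
          Pi.smul_apply, lp.infty_coeFn_one]
        simp only [lp.coeFn_sub, Pi.sub_apply, F, F', Pi.one_apply, smul_eq_mul, mul_one]
        push_cast
        rfl
      rw [h2]
      exact Complex.zero_le_real.2 (sub_pos.2 (hsum k)).le)
    rw [map_sub, map_sum, map_smul, hm1] at h1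
    simp only [map_sub, hF, sub_self, Finset.sum_const_zero, zero_sub, smul_eq_mul, mul_one] at h1
    rw [← Complex.ofReal_neg, Complex.zero_le_real] at h1
    linarith

/-- The version for right translation, by inversion. -/
theorem IsAmenableGroup.exists_almost_right_invariant {K : Type*} [Group K]
    (hK : IsAmenableGroup K) (S : Finset K) {ε : ℝ} (hε : 0 < ε) :
    ∃ (A : Finset K) (p : K → ℝ), (∀ k, 0 ≤ p k) ∧ (∀ k ∉ A, p k = 0) ∧ ∑ k ∈ A, p k = 1 ∧
      ∀ s ∈ S, ∑ k ∈ A, max (p k - p (k * s)) 0 ≤ ε := by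
  obtain ⟨p, hp, hp1, hinv⟩ := hK.exists_almost_left_invariant S hε
  refine ⟨p.support.image (·⁻¹), fun k => p k⁻¹, fun k => hp _, fun k hk => ?_, ?_, fun s hs => ?_⟩
  · by_contra h
    exact hk (Finset.mem_image.2 ⟨k⁻¹, Finsupp.mem_support_iff.2 h, inv_inv k⟩)
  · rw [Finset.sum_image inv_injective.injOn]
    simpa using hp1
  · rw [Finset.sum_image inv_injective.injOn]
    refine le_trans (Finset.sum_le_sum fun k _ => ?_) (hinv s hs p.support)
    simp only [mul_inv_rev, inv_inv]
    rw [abs_sub_comm]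
    exact max_le (le_abs_self _) (abs_nonneg _)

variable {X G : Type*} [Group G] [Fintype X]

/-- If the kernel of the quotient map is amenable, then the isoperimetric constants agree: lift a
finite set `B` of the quotient to the function on `G` which, on the coset of `q ∈ B`, is a translate
of an almost invariant probability measure on the kernel. -/
theorem isoConst_le_of_isAmenableGroup (G₁ : Subgroup G) [G₁.Normal] (h₁ : IsAmenableGroup G₁)
    (s : X → G) :
    isoConst s ≤ isoConst (fun x => (QuotientGroup.mk' G₁) (s x)) := by
  set π := QuotientGroup.mk' G₁ with hπ
  refine le_isoConst fun B _ => ?_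
  let σ : G ⧸ G₁ → G := Quotient.out
  have hσ : ∀ q, π (σ q) = q := fun q => Quotient.out_eq q
  have hker : ∀ g, π g = 1 ↔ g ∈ G₁ := fun g => by
    rw [← MonoidHom.mem_ker, QuotientGroup.ker_mk']
  -- the `G₁`-component of an element, relative to the section `σ`
  let κ : G → G₁ := fun g => ⟨g * (σ (π g))⁻¹, by
    rw [← hker, map_mul, map_inv, hσ, mul_inv_cancel]⟩
  have hπk : ∀ (k : G₁) g, π (k * g) = π g := fun k g => by
    have : π (k : G) = 1 := by
      rw [hker]
      exact k.2
    rw [map_mul, this, one_mul]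
  have hκk : ∀ (k : G₁) g, κ (k * g) = k * κ g := fun k g => by
    ext
    simp only [κ, hπk, Subgroup.coe_mul, mul_assoc]
  have hκσ : ∀ q, κ (σ q) = 1 := fun q => by
    ext
    simp only [κ, hσ, mul_inv_cancel, Subgroup.coe_one]
  refine le_of_forall_pos_le_add fun ε hε => ?_
  obtain ⟨ε', hε', hle⟩ : ∃ ε' > 0, Fintype.card X * (#B * ε') ≤ ε := by
    refine ⟨ε / (Fintype.card X * #B + 1), by positivity, ?_⟩
    rw [← mul_assoc, ← mul_div_assoc, div_le_iff₀ (by positivity)]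
    nlinarith
  obtain ⟨A, p, hp, hpA, hp1, hinv⟩ := h₁.exists_almost_right_invariant
    ((B ×ˢ (Finset.univ : Finset X)).image fun e => κ (σ e.1 * s e.2)) hε'
  -- the measure `p` on each of the cosets in `B`
  let f : G → ℝ := fun g => if π g ∈ B then p (κ g) else 0
  have hf : ∀ g, 0 ≤ f g := fun g => by
    simp only [f]
    split_ifs
    exacts [hp _, le_rfl]
  have hfσ : ∀ (k : G₁), ∀ q ∈ B, f (k * σ q) = p k := fun k q hq => by
    simp only [f, hπk, hσ, if_pos hq, hκk, hκσ, mul_one]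
  have hinj : Function.Injective fun e : (G ⧸ G₁) × G₁ => (e.2 : G) * σ e.1 := by
    rintro ⟨q, k⟩ ⟨q', k'⟩ h
    have h1 := congrArg π h
    have h2 := congrArg κ h
    simp only [hπk, hσ] at h1
    simp only [hκk, hκσ, mul_one] at h2
    rw [h1, h2]
  -- a finite set that contains the support of `f`
  let A' : Finset G := (B ×ˢ A).image fun e => (e.2 : G) * σ e.1
  have hA' : ∀ F : G → ℝ, ∑ g ∈ A', F g = ∑ q ∈ B, ∑ k ∈ A, F (k * σ q) := fun F => by
    rw [Finset.sum_image hinj.injOn, Finset.sum_product]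
  have hfA' : ∀ g ∉ A', f g = 0 := by
    intro g hg
    by_contra h
    simp only [f, ite_eq_right_iff, Classical.not_imp] at h
    refine hg (Finset.mem_image.2 ⟨(π g, κ g), Finset.mem_product.2 ⟨h.1, ?_⟩, ?_⟩)
    · by_contra h'
      exact h.2 (hpA _ h')
    · simp only [κ, inv_mul_cancel_right]
  have h := isoConst_mul_sum_le s A' f hf hfA'
  have hsum : ∑ g ∈ A', f g = #B := by
    rw [hA', Finset.sum_congr rfl fun q hq => (Finset.sum_congr rfl fun k _ => hfσ k q hq).trans hp1]
    simp
  rw [hsum] at h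
  refine h.trans ?_
  have hx : ∀ x, ∑ g ∈ A', max (f g - f (g * s x)) 0 ≤
      #{q ∈ B | q * π (s x) ∉ B} + #B * ε' := by
    intro x
    rw [hA', Finset.card_filter, Nat.cast_sum, ← nsmul_eq_mul, ← Finset.sum_const,
      ← Finset.sum_add_distrib]
    refine Finset.sum_le_sum fun q hq => ?_
    by_cases hqx : q * π (s x) ∈ B
    · rw [if_neg (not_not.2 hqx), Nat.cast_zero, zero_add]
      refine le_trans (Finset.sum_le_sum fun k _ => ?_) (hinv (κ (σ q * s x))
        (Finset.mem_image.2 ⟨(q, x), Finset.mem_product.2 ⟨hq, Finset.mem_univ x⟩, rfl⟩))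
      rw [hfσ k q hq, mul_assoc]
      simp only [f, hπk, map_mul, hσ, if_pos hqx, hκk]
      exact le_rfl
    · rw [if_pos hqx, Nat.cast_one]
      have : ∑ k ∈ A, max (f (k * σ q) - f (k * σ q * s x)) 0 ≤ ∑ k ∈ A, p k := by
        refine Finset.sum_le_sum fun k _ => ?_
        rw [hfσ k q hq]
        exact max_le (sub_le_self _ (hf _)) (hp _)
      linarith
  refine (Finset.sum_le_sum fun x _ => hx x).trans ?_
  rw [Finset.sum_add_distrib, Finset.sum_const, nsmul_eq_mul, Finset.card_univ, outBoundary,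
    Nat.cast_sum]
  -- the two sides differ in the instances that decide equality in the quotient
  refine add_le_add (le_of_eq (Finset.sum_congr rfl fun x _ => ?_)) hle
  congr!

end Amenable

/-! ### Comparison of the cyclomatic quotients -/

/-- Here `1 / |G|` is `0` when `G` is infinite, since `Nat.card G = 0` in that case. -/
theorem theorem3p1 {X G : Type*} [Fintype X] [Group G] (α : GroupPresentation X G)
    (G₁ : Subgroup G) [G₁.Normal] (α₂ : GroupPresentation X (G ⧸ G₁)) (h₂ : α₂.IsInducedBy α) :
    α.normalizedCyclomaticQuotient ≤
        α₂.normalizedCyclomaticQuotient -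
          (1 / (Nat.card (G ⧸ G₁) : ℝ) - 1 / (Nat.card G : ℝ)) ∧
      (IsAmenableGroup G₁ →
        α.normalizedCyclomaticQuotient =
          α₂.normalizedCyclomaticQuotient -
            (1 / (Nat.card (G ⧸ G₁) : ℝ) - 1 / (Nat.card G : ℝ))) := by
  have hgen : α₂.gen = fun x => QuotientGroup.mk' G₁ (α.gen x) := funext h₂
  have hle := isoConst_comp_le (QuotientGroup.mk' G₁) α.gen
  rw [← hgen] at hle
  rw [α.normalizedCyclomaticQuotient_eq, α₂.normalizedCyclomaticQuotient_eq]
  refine ⟨by linarith, fun hG₁ => ?_⟩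
  have hge := isoConst_le_of_isAmenableGroup G₁ hG₁ α.gen
  rw [← hgen] at hge
  linarith
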